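/- Throughout, for a Euclidean ball $B=B(p,r)\subset\mathbb C^n$ ($n\ge1$, $r>0$) and $\eta>1$, write $B^\eta=B(p,r/\eta)$. For a function $f$ and a set $A$ put $M_A(f)=\max_{\bar A}|f|$. Let $R$ be holomorphic on a neighbourhood of $\bar B$ and not identically zero on $B$. Its Bernstein index with gap $2$ is $$\mathfrak B=\mathfrak B_B^2(R)=\sup_{L}\ \ln\frac{M_{B\cap L}(R)}{M_{\bar B^{2}\cap L}(R)}\in[0,\infty],$$ where $L$ ranges over the complex lines through $p$ on which $R$ does not vanish identically. Let $X_R=B\cap\{R=0\}$. A Weierstrass polydisc for $X_R$ is a polydisc $\Delta=\Delta_z\times\Delta_w$ in a coordinate system $(z,w)\in\mathbb C^{n-1}\times\mathbb C$ obtained from the standard coordinates by an affine unitary transformation, such that $\bar\Delta\subset B$ and $(\bar\Delta_z\times\partial\Delta_w)\cap X_R=\emptyset$. Its degree $e(X_R,\Delta)$ is the degree of the branched cover $X_R\cap\Delta\to\Delta_z$, i.e. the number of points in a generic fibre, which is the largest number of points in a fibre. Its degree with multiplicities, in which each component of $X_R$ counts with its multiplicity as a zero of $R$, is the number of zeros of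 $w\mapsto R(z,w)$ in $\Delta_w$, counted with multiplicity, which is the same for all $z\in\Delta_z$. Proposition. There are an absolute constant $A$ and, for each $n\ge1$, a constant $C_n$ depending only on $n$ such that for all $B\subset\mathbb C^n$ and $R$ as above there exist a Weierstrass polydisc $\Delta$ for $X_R$ and $\eta>1$ with $$B^\eta\subset\Delta\subset B,\qquad \eta\le e^{C_n(1+\mathfrak B)},$$ $$e(X_R,\Delta)\le A\,\mathfrak B,$$ and the last bound also holds for the degree of $X_R$ with multiplicities. -/

import Mathlib

open scoped ENNReal NNReal

noncomputable section

/-- `M_A(f)`, the maximum of `|f|` on the closure of `A`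
(it is attained whenever `f` is continuous on the closure of `A` and that closure is compact). -/
def maxModulus {E : Type*} [TopologicalSpace E] (A : Set E) (f : E → ℂ) : ℝ :=
  sSup ((fun x => ‖f x‖) '' closure A)

/-- The Bernstein index `ln (M_U(f) / M_K(f))` of `f` with respect to the pair `K ⊆ U`. -/
def bernsteinIndex {E : Type*} [TopologicalSpace E] (K U : Set E) (f : E → ℂ) : ℝ :=
  Real.log (maxModulus U f / maxModulus K f)

/-- The complex line through `p` with direction `v` (`v ≠ 0`). -/
def complexLine {E : Type*} [AddCommGroup E] [Module ℂ E] (p v : E) : Set E :=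
  {x | ∃ t : ℂ, x = p + t • v}

/-- The Bernstein index of `F` with respect to a ball `B = B(p, r)` and `K ⊆ B`: the supremum of the
Bernstein indices of the restrictions of `F` to the pairs `K ∩ L ⊆ B ∩ L`, where `L` ranges over the
complex lines through the center `p`. Lines on which `F` vanishes identically, where the quotient of
the maxima is `0 / 0`, are left out. All the indices are nonnegative because `K ⊆ B`, so the
supremum is taken in `[0, ∞]`. -/
def ballBernsteinIndex {n : ℕ} (K : Set (EuclideanSpace ℂ (Fin n)))
    (p : EuclideanSpace ℂ (Fin n)) (r : ℝ) (F : EuclideanSpace ℂ (Fin n) → ℂ) : ℝ≥0∞ :=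
  ⨆ (v : EuclideanSpace ℂ (Fin n)) (_ : v ≠ 0)
    (_ : ∃ x ∈ Metric.ball p r ∩ complexLine p v, F x ≠ 0),
    ENNReal.ofReal
      (bernsteinIndex (K ∩ complexLine p v) (Metric.ball p r ∩ complexLine p v) F)

/-- The index `𝔅_B^η(F)` of the ball `B = B(p, r)` with gap `η > 1`: here `K` is the closure of
`B^η`, the ball shrunk about its center by the factor `η`. -/
def gapBernsteinIndex {n : ℕ} (η : ℝ) (p : EuclideanSpace ℂ (Fin n)) (r : ℝ)
    (F : EuclideanSpace ℂ (Fin n) → ℂ) : ℝ≥0∞ :=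
  ballBernsteinIndex (Metric.closedBall p (r / η)) p r F

/-- A polydisc `Δ = Δ_z × Δ_w` in `ℂⁿ`, in a standard coordinate system `x = z × w`, that is, one
obtained from the standard coordinates by an affine unitary transformation. Here `z` has `m` and
`w` has `k` coordinates (so that necessarily `n = m + k`). -/
structure StdPolydisc (n m k : ℕ) where
  coord : EuclideanSpace ℂ (Fin n) ≃ᵃⁱ[ℂ] EuclideanSpace ℂ (Fin m ⊕ Fin k)
  zCenter : Fin m → ℂ
  wCenter : Fin k → ℂ
  zRadius : Fin m → ℝ
  wRadius : Fin k → ℝ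
  zRadius_pos : ∀ i, 0 < zRadius i
  wRadius_pos : ∀ j, 0 < wRadius j

namespace StdPolydisc

variable {n m k : ℕ} (Δ : StdPolydisc n m k)

/-- The projection `π_z`. -/
def projZ (x : EuclideanSpace ℂ (Fin n)) : Fin m → ℂ := fun i => Δ.coord x (Sum.inl i)

/-- The projection to the `w`-coordinates. -/
def projW (x : EuclideanSpace ℂ (Fin n)) : Fin k → ℂ := fun j => Δ.coord x (Sum.inr j)

/-- The point of `ℂⁿ` with coordinates `z × w`. -/
def point (z : Fin m → ℂ) (w : Fin k → ℂ) : EuclideanSpace ℂ (Fin n) :=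
  Δ.coord.symm (WithLp.toLp 2 (Sum.elim z w))

/-- The base `Δ_z`. -/
def base : Set (Fin m → ℂ) := {z | ∀ i, ‖z i - Δ.zCenter i‖ < Δ.zRadius i}

/-- The fiber `Δ_w`. -/
def fiber : Set (Fin k → ℂ) := {w | ∀ j, ‖w j - Δ.wCenter j‖ < Δ.wRadius j}

/-- The polydisc `Δ_z × Δ_w` as a subset of `ℂⁿ`. -/
def carrier : Set (EuclideanSpace ℂ (Fin n)) := {x | Δ.projZ x ∈ Δ.base ∧ Δ.projW x ∈ Δ.fiber}

/-- `Δ` is a Weierstrass polydisc for the analytic subset `X` of `Ω`, of pure dimension `m`: the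
closure of `Δ` lies in `Ω`, and `X` does not meet `closure Δ_z × ∂Δ_w`. -/
def IsWeierstrass (Ω X : Set (EuclideanSpace ℂ (Fin n))) : Prop :=
  closure Δ.carrier ⊆ Ω ∧
    {x | Δ.projZ x ∈ closure Δ.base ∧ Δ.projW x ∈ frontier Δ.fiber} ∩ X = ∅

/-- The degree `e(X, Δ)` of the branched cover `π_z : X ∩ Δ → Δ_z`: the number of points in a
generic fiber, which is the largest number of points in a fiber. -/
def degree (X : Set (EuclideanSpace ℂ (Fin n))) : ℕ∞ :=
  ⨆ z ∈ Δ.base, (X ∩ Δ.carrier ∩ {x | Δ.projZ x = z}).encard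

end StdPolydisc

/-- `g` has finitely many zeros in `D`, and there are `e` of them when each is counted with its
multiplicity. -/
def HasZeroCount (g : ℂ → ℂ) (D : Set ℂ) (e : ℕ) : Prop :=
  ∃ s : Finset ℂ, (∀ w, w ∈ s ↔ w ∈ D ∧ g w = 0) ∧ ∑ w ∈ s, analyticOrderAt g w = (e : ℕ∞)

/-- `e` is the degree over `Δ_z` of the hypersurface `{R = 0}` with its cycle structure, where each
component counts with its multiplicity as a zero of `R`: the projection `π_z` from `{R = 0} ∩ Δ` to
`Δ_z` is `e`-to-one when the points over `z` are counted with their multiplicities as zeros of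
`w ↦ R(z, w)` in `Δ_w`. -/
def StdPolydisc.HasCycleDegree {n m : ℕ} (Δ : StdPolydisc n m 1)
    (R : EuclideanSpace ℂ (Fin n) → ℂ) (e : ℕ) : Prop :=
  ∀ z ∈ Δ.base, HasZeroCount (fun w => R (Δ.point z fun _ => w)) {w | (fun _ => w) ∈ Δ.fiber} e

end

/-!
Let `M` be the maximum of `|R|` on the closed ball. On the line through `p` and a maximum point, `R`
restricts to a function `f` of one variable with `max |f| = M` on the large disc and `|f(t)| = q M`
for a maximum point `t` in the half disc, where `log (1 / q)` is at most the Bernstein index. After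
division by a Blaschke product, Harnack's inequality for `log (M / |f|)` bounds the zero-free part
from below by a power of `q`. Each Blaschke factor is at most `10 / 11` at `t`, so the number `N` of
zeros satisfies `q ≤ (10 / 11) ^ N`, and by Chebyshev's lower bound for the sup norm of a monic
polynomial the Blaschke product is at least `22 ^ (-N)` on some circle. Hence `|f| ≥ M q ^ 58` on a
circle of radius comparable to `r`. By the Schwarz lemma `R` changes by less than this when the
circle is moved by `δ ≈ r q ^ 58` in the orthogonal directions, so by Rouché's theorem the polydisc
of base radius `δ` around the disc is a Weierstrass polydisc, with the same number of zeros in every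
fiber.
-/

open Metric Set Topology

section Factorization

variable {𝕜 E : Type*} [NontriviallyNormedField 𝕜] [NormedAddCommGroup E] [NormedSpace 𝕜 E]
  {f : 𝕜 → E} {U K : Set 𝕜}

theorem exists_eq_sub_pow_smul {a : 𝕜} (hf : AnalyticOnNhd 𝕜 f U) (ha : AnalyticAt 𝕜 f a)
    (hord : analyticOrderAt f a ≠ ⊤) :
    ∃ h : 𝕜 → E, AnalyticOnNhd 𝕜 h U ∧ h a ≠ 0 ∧
      ∀ w, f w = (w - a) ^ analyticOrderNatAt f a • h w := by
  classical
  obtain ⟨g, hg, hga, hfg⟩ := ha.analyticOrderAt_ne_top.1 hord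
  set n := analyticOrderNatAt f a
  set h := Function.update (fun w => ((w - a) ^ n)⁻¹ • f w) a (g a)
  have hpow : ∀ w ≠ a, (w - a) ^ n ≠ 0 := fun w hw => pow_ne_zero _ (sub_ne_zero.2 hw)
  have hoff : ∀ w ≠ a, h w = ((w - a) ^ n)⁻¹ • f w := fun w hw => Function.update_of_ne hw ..
  have hnear : h =ᶠ[𝓝 a] g := by
    filter_upwards [hfg] with w hw
    rcases eq_or_ne w a with rfl | hwa
    · exact Function.update_self ..
    · rw [hoff w hwa, hw, inv_smul_smul₀ (hpow w hwa)]
  refine ⟨h, fun w hw => ?_, by rwa [hnear.eq_of_nhds], fun w => ?_⟩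
  · rcases eq_or_ne w a with rfl | hwa
    · exact hg.congr hnear.symm
    · have hquot : AnalyticAt 𝕜 (fun w => ((w - a) ^ n)⁻¹ • f w) w :=
        ((by fun_prop : AnalyticAt 𝕜 (fun w => (w - a) ^ n) w).inv (hpow w hwa)).smul (hf w hw)
      exact hquot.congr ((isOpen_ne.eventually_mem hwa).mono fun z hz => (hoff z hz).symm)
  · rcases eq_or_ne w a with rfl | hwa
    · rw [hnear.eq_of_nhds]
      exact hfg.self_of_nhds
    · rw [hoff w hwa, smul_inv_smul₀ (hpow w hwa)]

theorem exists_eq_prod_sub_pow_smul (s : Finset 𝕜) (hf : AnalyticOnNhd 𝕜 f U) (hs : ↑s ⊆ U)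
    (hord : ∀ a ∈ s, analyticOrderAt f a ≠ ⊤) :
    ∃ h : 𝕜 → E, AnalyticOnNhd 𝕜 h U ∧ (∀ a ∈ s, h a ≠ 0) ∧
      ∀ w, f w = (∏ a ∈ s, (w - a) ^ analyticOrderNatAt f a) • h w := by
  classical
  induction s using Finset.induction_on with
  | empty => exact ⟨f, hf, by simp, by simp⟩
  | insert a s has ih =>
    rw [Finset.coe_insert, insert_subset_iff] at hs
    rw [Finset.forall_mem_insert] at hord
    obtain ⟨g, hg, hgs, hfg⟩ := ih hs.2 hord.2
    have hfactor : AnalyticAt 𝕜 (fun w => ∏ b ∈ s, (w - b) ^ analyticOrderNatAt f b) a := by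
      fun_prop
    have hfactor0 : ∏ b ∈ s, (a - b) ^ analyticOrderNatAt f b ≠ 0 :=
      Finset.prod_ne_zero_iff.2 fun b hb =>
        pow_ne_zero _ (sub_ne_zero.2 (ne_of_mem_of_not_mem hb has).symm)
    have hga : analyticOrderAt g a = analyticOrderAt f a := by
      rw [show f = (fun w => ∏ b ∈ s, (w - b) ^ analyticOrderNatAt f b) • g from funext hfg,
        analyticOrderAt_smul hfactor (hg a hs.1), hfactor.analyticOrderAt_eq_zero.2 hfactor0,
        zero_add]
    obtain ⟨h, hh, hha, hgh⟩ := exists_eq_sub_pow_smul hg (hg a hs.1) (hga ▸ hord.1)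
    refine ⟨h, hh, (Finset.forall_mem_insert ..).2 ⟨hha, fun b hb h0 => ?_⟩, fun w => ?_⟩
    · exact hgs b hb (by rw [hgh, h0, smul_zero])
    · rw [Finset.prod_insert has, mul_comm, mul_smul, hfg, hgh, analyticOrderNatAt,
        analyticOrderNatAt, hga]

theorem finite_zeros_of_isCompact (hf : AnalyticOnNhd 𝕜 f U) (hU : IsPreconnected U)
    (hne : ∃ x ∈ U, f x ≠ 0) (hK : IsCompact K) (hKU : K ⊆ U) :
    {w | w ∈ K ∧ f w = 0}.Finite := by
  by_contra hinf
  obtain ⟨x, hxK, hx⟩ := Infinite.exists_accPt_of_subset_isCompact hinf hK fun w hw => hw.1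
  obtain ⟨y, hy, hfy⟩ := hne
  refine hfy (hf.eqOn_zero_of_preconnected_of_frequently_eq_zero hU (hKU hxK) ?_ hy)
  exact (accPt_iff_frequently_nhdsNE.1 hx).mono fun w hw => hw.2

theorem analyticOrderAt_ne_top_of_exists_ne_zero (hf : AnalyticOnNhd 𝕜 f U)
    (hU : IsPreconnected U) (hne : ∃ x ∈ U, f x ≠ 0) {a : 𝕜} (ha : a ∈ U) :
    analyticOrderAt f a ≠ ⊤ := by
  obtain ⟨x, hx, hfx⟩ := hne
  refine hf.analyticOrderAt_ne_top_of_isPreconnected hU hx ha ?_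
  rw [(hf x hx).analyticOrderAt_eq_zero.2 hfx]
  exact ENat.zero_ne_top

theorem exists_eq_prod_zeros_smul (hf : AnalyticOnNhd 𝕜 f U) (hU : IsPreconnected U)
    (hne : ∃ x ∈ U, f x ≠ 0) (hK : IsCompact K) (hKU : K ⊆ U) :
    ∃ (s : Finset 𝕜) (h : 𝕜 → E), (∀ w, w ∈ s ↔ w ∈ K ∧ f w = 0) ∧ AnalyticOnNhd 𝕜 h U ∧
      (∀ w ∈ K, h w ≠ 0) ∧ ∀ w, f w = (∏ a ∈ s, (w - a) ^ analyticOrderNatAt f a) • h w := by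
  have hfin := finite_zeros_of_isCompact hf hU hne hK hKU
  have hs : ∀ w, w ∈ hfin.toFinset ↔ w ∈ K ∧ f w = 0 := fun w => hfin.mem_toFinset
  have hsU : ∀ a ∈ hfin.toFinset, a ∈ U := fun a ha => hKU ((hs a).1 ha).1
  obtain ⟨h, hh, hhs, hfh⟩ := exists_eq_prod_sub_pow_smul hfin.toFinset hf hsU
    fun a ha => analyticOrderAt_ne_top_of_exists_ne_zero hf hU hne (hsU a ha)
  refine ⟨hfin.toFinset, h, hs, hh, fun w hw h0 => ?_, hfh⟩
  exact hhs w ((hs w).2 ⟨hw, by rw [hfh, h0, smul_zero]⟩) h0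

end Factorization

section ArgumentPrinciple

open Complex

variable {f g : ℂ → ℂ} {c : ℂ} {ρ : ℝ} {D D' : Set ℂ} {e e' : ℕ}

namespace HasZeroCount

theorem sum_analyticOrderNatAt {s : Finset ℂ} (hs : ∀ w, w ∈ s ↔ w ∈ D ∧ f w = 0)
    (hord : ∀ a ∈ s, analyticOrderAt f a ≠ ⊤) :
    HasZeroCount f D (∑ a ∈ s, analyticOrderNatAt f a) := by
  refine ⟨s, hs, ?_⟩
  rw [Nat.cast_sum]
  exact Finset.sum_congr rfl fun a ha => (Nat.cast_analyticOrderNatAt (hord a ha)).symm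

theorem mono (he : HasZeroCount f D e) (he' : HasZeroCount f D' e') (hD : D ⊆ D') : e ≤ e' := by
  obtain ⟨s, hs, hse⟩ := he
  obtain ⟨t, ht, hte⟩ := he'
  have hst : s ⊆ t := fun w hw => (ht w).2 ⟨hD ((hs w).1 hw).1, ((hs w).1 hw).2⟩
  rw [← Nat.cast_le (α := ℕ∞), ← hse, ← hte]
  exact Finset.sum_le_sum_of_subset hst

theorem unique (he : HasZeroCount f D e) (he' : HasZeroCount f D e') : e = e' :=
  le_antisymm (he.mono he' Subset.rfl) (he'.mono he Subset.rfl)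

theorem exists_card_le (hf : AnalyticOnNhd ℂ f D) (he : HasZeroCount f D e) :
    ∃ s : Finset ℂ, (∀ w, w ∈ s ↔ w ∈ D ∧ f w = 0) ∧ s.card ≤ e := by
  obtain ⟨s, hs, hse⟩ := he
  refine ⟨s, hs, ?_⟩
  rw [← Nat.cast_le (α := ℕ∞), ← hse, Finset.card_eq_sum_ones, Nat.cast_sum]
  refine Finset.sum_le_sum fun w hw => ?_
  have hw' := (hs w).1 hw
  rw [Nat.cast_one, Order.one_le_iff_ne_zero]
  exact (hf w hw'.1).analyticOrderAt_ne_zero.2 hw'.2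

end HasZeroCount

theorem analyticOnNhd_logDeriv (hf : AnalyticOnNhd ℂ f D) (hf0 : ∀ w ∈ D, f w ≠ 0) :
    AnalyticOnNhd ℂ (logDeriv f) D := fun w hw => (hf w hw).deriv.div (hf w hw) (hf0 w hw)

theorem circleIntegral_logDeriv_eq_zero (hρ : 0 ≤ ρ) (hf : AnalyticOnNhd ℂ f (closedBall c ρ))
    (hf0 : ∀ w ∈ closedBall c ρ, f w ≠ 0) : (∮ w in C(c, ρ), logDeriv f w) = 0 :=
  have hlog := analyticOnNhd_logDeriv hf hf0
  circleIntegral_eq_zero_of_differentiable_on_off_countable hρ countable_empty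
    hlog.continuousOn fun w hw => (hlog w (ball_subset_closedBall hw.1)).differentiableAt

theorem logDeriv_prod_sub_pow (s : Finset ℂ) (n : ℂ → ℕ) {w : ℂ} (hw : w ∉ s) :
    logDeriv (fun w => ∏ a ∈ s, (w - a) ^ n a) w = ∑ a ∈ s, (n a : ℂ) * (w - a)⁻¹ := by
  have hwa : ∀ a ∈ s, w - a ≠ 0 := fun a ha => sub_ne_zero.2 (ne_of_mem_of_not_mem ha hw).symm
  rw [logDeriv_prod (f := fun a w => (w - a) ^ n a) (fun a ha => pow_ne_zero _ (hwa a ha))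
    (fun a _ => by fun_prop)]
  refine Finset.sum_congr rfl fun a _ => ?_
  rw [logDeriv_fun_pow (by fun_prop)]
  simp [logDeriv_apply]

theorem circleIntegral_logDeriv_prod_sub_pow (s : Finset ℂ) (n : ℂ → ℕ) (hρ : 0 ≤ ρ)
    (hs : ∀ a ∈ s, a ∈ ball c ρ) :
    CircleIntegrable (logDeriv fun w => ∏ a ∈ s, (w - a) ^ n a) c ρ ∧
      (∮ w in C(c, ρ), logDeriv (fun w => ∏ a ∈ s, (w - a) ^ n a) w) =
        2 * Real.pi * I * ∑ a ∈ s, n a := by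
  have hoff : ∀ w ∈ sphere c ρ, w ∉ s := fun w hw hws =>
    (mem_ball.1 (hs w hws)).ne (mem_sphere.1 hw)
  have heq : EqOn (logDeriv fun w => ∏ a ∈ s, (w - a) ^ n a)
      (fun w => ∑ a ∈ s, (n a : ℂ) * (w - a)⁻¹) (sphere c ρ) :=
    fun w hw => logDeriv_prod_sub_pow s n (hoff w hw)
  have hcont : ∀ a ∈ s, ContinuousOn (fun w => (n a : ℂ) * (w - a)⁻¹) (sphere c ρ) := fun a ha =>
    continuousOn_const.mul (ContinuousOn.inv₀ (by fun_prop) fun w hw =>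
      sub_ne_zero.2 fun h => hoff w hw (h ▸ ha))
  refine ⟨((continuousOn_finsetSum _ hcont).congr heq).circleIntegrable hρ, ?_⟩
  rw [circleIntegral.integral_congr hρ heq,
    circleIntegral.integral_fun_sum fun a ha => (hcont a ha).circleIntegrable hρ,
    Nat.cast_sum, Finset.mul_sum]
  refine Finset.sum_congr rfl fun a ha => ?_
  rw [circleIntegral.integral_const_mul, circleIntegral.integral_sub_inv_of_mem_ball (hs a ha),
    mul_comm]

theorem exists_hasZeroCount_circleIntegral_logDeriv_eq (hρ : 0 ≤ ρ)
    (hf : AnalyticOnNhd ℂ f (closedBall c ρ)) (hf0 : ∀ w ∈ sphere c ρ, f w ≠ 0) :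
    ∃ e : ℕ, HasZeroCount f (ball c ρ) e ∧
      (∮ w in C(c, ρ), logDeriv f w) = 2 * Real.pi * I * e := by
  have hconn : IsPreconnected (closedBall c ρ) := (convex_closedBall c ρ).isPreconnected
  obtain ⟨x, hx⟩ : (sphere c ρ).Nonempty := NormedSpace.sphere_nonempty.2 hρ
  have hne : ∃ x ∈ closedBall c ρ, f x ≠ 0 := ⟨x, sphere_subset_closedBall hx, hf0 x hx⟩
  obtain ⟨s, h, hs, hh, hh0, hfh⟩ :=
    exists_eq_prod_zeros_smul hf hconn hne (isCompact_closedBall c ρ) subset_rfl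
  simp only [smul_eq_mul] at hfh
  have hs' : ∀ w, w ∈ s ↔ w ∈ ball c ρ ∧ f w = 0 := fun w => by
    rw [hs, ← ball_union_sphere, mem_union, or_and_right, or_iff_left fun hw => hf0 w hw.1 hw.2]
  have hsb : ∀ a ∈ s, a ∈ ball c ρ := fun a ha => ((hs' a).1 ha).1
  refine ⟨_, .sum_analyticOrderNatAt hs' fun a ha =>
    analyticOrderAt_ne_top_of_exists_ne_zero hf hconn hne ((hs a).1 ha).1, ?_⟩
  obtain ⟨hint, hval⟩ := circleIntegral_logDeriv_prod_sub_pow s (analyticOrderNatAt f) hρ hsb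
  have hmul : EqOn (logDeriv f) (fun w =>
      logDeriv (fun w => ∏ a ∈ s, (w - a) ^ analyticOrderNatAt f a) w + logDeriv h w)
      (sphere c ρ) := fun w hw => by
    have hwc := sphere_subset_closedBall hw
    have hprod : ∏ a ∈ s, (w - a) ^ analyticOrderNatAt f a ≠ 0 :=
      left_ne_zero_of_mul (hfh w ▸ hf0 w hw)
    exact (congrFun (congrArg logDeriv (funext hfh)) w).trans
      (logDeriv_mul w hprod (hh0 w hwc) (by fun_prop) (hh w hwc).differentiableAt)
  rw [circleIntegral.integral_congr hρ hmul, circleIntegral.integral_add hint, hval,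
    circleIntegral_logDeriv_eq_zero hρ hh hh0, add_zero]
  exact ((analyticOnNhd_logDeriv hh hh0).continuousOn.mono
    sphere_subset_closedBall).circleIntegrable hρ

theorem HasZeroCount.circleIntegral_logDeriv_eq (hρ : 0 ≤ ρ)
    (hf : AnalyticOnNhd ℂ f (closedBall c ρ)) (hf0 : ∀ w ∈ sphere c ρ, f w ≠ 0)
    (he : HasZeroCount f (ball c ρ) e) :
    (∮ w in C(c, ρ), logDeriv f w) = 2 * Real.pi * I * e := by
  obtain ⟨e', he', hint⟩ := exists_hasZeroCount_circleIntegral_logDeriv_eq hρ hf hf0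
  rw [hint, he.unique he']

theorem circleIntegral_logDeriv_eq_of_norm_sub_lt_norm (hρ : 0 ≤ ρ)
    (hf : AnalyticOnNhd ℂ f (sphere c ρ)) (hg : AnalyticOnNhd ℂ g (sphere c ρ))
    (hfg : ∀ w ∈ sphere c ρ, ‖g w - f w‖ < ‖f w‖) :
    (∮ w in C(c, ρ), logDeriv g w) = ∮ w in C(c, ρ), logDeriv f w := by
  have hf0 : ∀ w ∈ sphere c ρ, f w ≠ 0 := fun w hw =>
    norm_pos_iff.1 ((norm_nonneg _).trans_lt (hfg w hw))
  have hg0 : ∀ w ∈ sphere c ρ, g w ≠ 0 := fun w hw h0 => by simpa [h0] using hfg w hw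
  have hslit : ∀ w ∈ sphere c ρ, g w / f w ∈ slitPlane := fun w hw => by
    refine ball_one_subset_slitPlane ?_
    rw [mem_ball_iff_norm, div_sub_one (hf0 w hw), norm_div, div_lt_one (norm_pos_iff.2 (hf0 w hw))]
    exact hfg w hw
  have hintg := (analyticOnNhd_logDeriv hg hg0).continuousOn.circleIntegrable hρ
  have hintf := (analyticOnNhd_logDeriv hf hf0).continuousOn.circleIntegrable hρ
  rw [← sub_eq_zero, ← circleIntegral.integral_sub hintg hintf]
  refine circleIntegral.integral_eq_zero_of_hasDerivWithinAt
    (f := fun w => log (g w / f w)) hρ fun w hw => ?_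
  have hderiv := ((hg w hw).differentiableAt.hasDerivAt.div (hf w hw).differentiableAt.hasDerivAt
    (hf0 w hw)).clog (hslit w hw)
  refine hderiv.hasDerivWithinAt.congr_deriv ?_
  have := hf0 w hw
  have := hg0 w hw
  simp only [logDeriv_apply, Pi.div_apply]
  field_simp

theorem HasZeroCount.of_norm_sub_lt_norm (hρ : 0 ≤ ρ)
    (hf : AnalyticOnNhd ℂ f (closedBall c ρ)) (hg : AnalyticOnNhd ℂ g (closedBall c ρ))
    (hfg : ∀ w ∈ sphere c ρ, ‖g w - f w‖ < ‖f w‖)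
    (he : HasZeroCount f (ball c ρ) e) : HasZeroCount g (ball c ρ) e := by
  have hf0 : ∀ w ∈ sphere c ρ, f w ≠ 0 := fun w hw =>
    norm_pos_iff.1 ((norm_nonneg _).trans_lt (hfg w hw))
  have hg0 : ∀ w ∈ sphere c ρ, g w ≠ 0 := fun w hw h0 => by simpa [h0] using hfg w hw
  obtain ⟨e', he', hint⟩ := exists_hasZeroCount_circleIntegral_logDeriv_eq hρ hg hg0
  rw [circleIntegral_logDeriv_eq_of_norm_sub_lt_norm hρ (hf.mono sphere_subset_closedBall)
    (hg.mono sphere_subset_closedBall) hfg, he.circleIntegral_logDeriv_eq hρ hf hf0] at hint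
  have hee' : e = e' := by exact_mod_cast mul_left_cancel₀ two_pi_I_ne_zero hint
  rwa [hee']

end ArgumentPrinciple

section Harnack

open InnerProductSpace

theorem harnack_circleAverage {u : ℂ → ℝ} {c w : ℂ} {R : ℝ}
    (hu : HarmonicContOnCl u (ball c R)) (hu0 : ∀ z ∈ sphere c R, 0 ≤ u z) (hw : w ∈ ball c R) :
    (R - ‖w - c‖) / (R + ‖w - c‖) * Real.circleAverage u c R ≤ u w ∧
      u w ≤ (R + ‖w - c‖) / (R - ‖w - c‖) * Real.circleAverage u c R := by
  have hR : 0 < R := pos_of_mem_ball hw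
  have habs : |R| = R := abs_of_pos hR
  have hcont : ContinuousOn u (sphere c |R|) := hu.continuousOn_ball.mono <| by
    rw [habs]
    exact sphere_subset_closedBall
  have hint : CircleIntegrable u c R := hcont.circleIntegrable'
  have hker : CircleIntegrable ((Complex.re ∘ herglotzRieszKernel c w) • u) c R :=
    ((Complex.continuous_re.comp_continuousOn
      (continuousOn_herglotzRieszKernel_sphere hw)).smul hcont).circleIntegrable'
  rw [← hu.circleAverage_re_herglotzRieszKernel_smul hw, ← smul_eq_mul, ← smul_eq_mul,
    ← Real.circleAverage_smul, ← Real.circleAverage_smul]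
  refine ⟨Real.circleAverage_mono hint.const_smul hker fun z hz => ?_,
    Real.circleAverage_mono hker hint.const_smul fun z hz => ?_⟩
  · rw [habs] at hz
    exact mul_le_mul_of_nonneg_right (le_re_herglotzRieszKernel hz hw) (hu0 z hz)
  · rw [habs] at hz
    exact mul_le_mul_of_nonneg_right (re_herglotzRieszKernel_le hz hw) (hu0 z hz)

theorem harnack_closedBall {u : ℂ → ℝ} {c w₀ w : ℂ} {r R : ℝ}
    (hu : HarmonicContOnCl u (ball c R)) (hu0 : ∀ z ∈ sphere c R, 0 ≤ u z) (hrR : r < R)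
    (hw₀ : w₀ ∈ closedBall c r) (hw : w ∈ closedBall c r) :
    u w ≤ ((R + r) / (R - r)) ^ 2 * u w₀ := by
  have hlower := (harnack_circleAverage hu hu0 (closedBall_subset_ball hrR hw₀)).1
  have hupper := (harnack_circleAverage hu hu0 (closedBall_subset_ball hrR hw)).2
  rw [mem_closedBall_iff_norm] at hw₀ hw
  have hr : 0 ≤ r := (norm_nonneg _).trans hw
  have hgap : 0 < R - r := sub_pos.2 hrR
  have _ : 0 < R - ‖w - c‖ := hgap.trans_le (by gcongr)
  have havg : 0 ≤ Real.circleAverage u c R := Real.circleAverage_nonneg_of_nonneg fun z hz =>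
    hu0 z (by rwa [abs_of_pos (by linarith)] at hz)
  calc u w ≤ (R + ‖w - c‖) / (R - ‖w - c‖) * Real.circleAverage u c R := hupper
    _ ≤ (R + r) / (R - r) * Real.circleAverage u c R := by gcongr; linarith
    _ = ((R + r) / (R - r)) ^ 2 * ((R - r) / (R + r) * Real.circleAverage u c R) := by
      have : R + r ≠ 0 := by linarith
      field_simp
    _ ≤ ((R + r) / (R - r)) ^ 2 * ((R - ‖w₀ - c‖) / (R + ‖w₀ - c‖) *
        Real.circleAverage u c R) := by
      have : 0 < R + ‖w₀ - c‖ := by linarith [norm_nonneg (w₀ - c)]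
      gcongr
      linarith
    _ ≤ ((R + r) / (R - r)) ^ 2 * u w₀ := by gcongr

theorem mul_norm_div_rpow_le_norm {H : ℂ → ℂ} {c w₀ w : ℂ} {r R M : ℝ}
    (hH : AnalyticOnNhd ℂ H (closedBall c R)) (hH0 : ∀ z ∈ closedBall c R, H z ≠ 0)
    (hHM : ∀ z ∈ sphere c R, ‖H z‖ ≤ M) (hrR : r < R) (hw₀ : w₀ ∈ closedBall c r)
    (hw : w ∈ closedBall c r) :
    M * (‖H w₀‖ / M) ^ (((R + r) / (R - r)) ^ 2) ≤ ‖H w‖ := by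
  have hpos : ∀ z ∈ closedBall c R, 0 < ‖H z‖ := fun z hz => norm_pos_iff.2 (hH0 z hz)
  have hR : 0 < R := (dist_nonneg.trans hw).trans_lt hrR
  obtain ⟨x, hx⟩ : (sphere c R).Nonempty := NormedSpace.sphere_nonempty.2 hR.le
  have hM : 0 < M := (hpos x (sphere_subset_closedBall hx)).trans_le (hHM x hx)
  have hu : HarmonicOnNhd ((fun _ => Real.log M) - fun z => Real.log ‖H z‖) (closedBall c R) :=
    (harmonicOnNhd_const _).sub fun z hz => (hH z hz).harmonicAt_log_norm (hH0 z hz)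
  rw [← closure_ball c hR.ne'] at hu
  have hharnack := harnack_closedBall hu.harmonicContOnCl (fun z hz => sub_nonneg.2 <|
    Real.log_le_log (hpos z (sphere_subset_closedBall hz)) (hHM z hz)) hrR hw₀ hw
  simp only [Pi.sub_apply] at hharnack
  have hw₀' := hpos w₀ (closedBall_subset_closedBall hrR.le hw₀)
  have hw' := hpos w (closedBall_subset_closedBall hrR.le hw)
  rw [← Real.log_le_log_iff (by positivity) hw', Real.log_mul hM.ne' (by positivity),
    Real.log_rpow (by positivity), Real.log_div hw₀'.ne' hM.ne']
  linarith

end Harnack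

section Chebyshev

open Polynomial

theorem exists_mem_Icc_pow_natDegree_le_abs_eval {P : ℝ[X]} (hP : P.Monic) {l u : ℝ}
    (hlu : l < u) :
    ∃ x ∈ Icc l u, ((u - l) / 4) ^ P.natDegree ≤ |P.eval x| := by
  rcases Nat.eq_zero_or_pos P.natDegree with h0 | hpos
  · exact ⟨l, left_mem_Icc.2 hlu.le, by simp [hP.natDegree_eq_zero.1 h0]⟩
  by_contra! hlt
  set d := P.natDegree
  set ε := ((u - l) / 4) ^ d
  have hε : 0 < ε := pow_pos (by linarith) _
  set L : ℝ[X] := C ((u - l) / 2) * X + C ((u + l) / 2)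
  have hul : u - l ≠ 0 := sub_ne_zero.2 hlu.ne'
  have hu : (u - l) / 2 ≠ 0 := div_ne_zero hul two_ne_zero
  have hL : L.natDegree = 1 := natDegree_linear hu
  have hdeg : (C ε⁻¹ * P.comp L).degree ≤ d := by
    rw [degree_C_mul (inv_pos.2 hε).ne', ← mul_one d, ← hL, ← natDegree_comp]
    exact degree_le_natDegree
  have hlead := Polynomial.Chebyshev.leadingCoeff_le_of_forall_abs_le_one hdeg fun x hx => by
    have hLx : L.eval x = (u - l) / 2 * x + (u + l) / 2 := by simp [L]
    rw [eval_mul, eval_C, eval_comp, abs_mul, abs_of_pos (inv_pos.2 hε), inv_mul_le_one₀ hε, hLx]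
    exact (hlt _ ⟨by nlinarith [hx.1], by nlinarith [hx.2]⟩).le
  rw [leadingCoeff_mul, leadingCoeff_C, leadingCoeff_comp (by rw [hL]; exact one_ne_zero),
    hP.leadingCoeff, leadingCoeff_linear hu, one_mul, ← inv_pow, ← mul_pow,
    show ((u - l) / 4)⁻¹ * ((u - l) / 2) = 2 by field_simp; norm_num] at hlead
  exact absurd hlead (not_le.2 (pow_lt_pow_right₀ one_lt_two (by omega)))

theorem exists_mem_Icc_pow_sum_le_prod_abs_sub {ι : Type*} (s : Finset ι) (n : ι → ℕ) (x : ι → ℝ)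
    {l u : ℝ} (hlu : l < u) :
    ∃ ρ ∈ Icc l u, ((u - l) / 4) ^ (∑ i ∈ s, n i) ≤ ∏ i ∈ s, |ρ - x i| ^ n i := by
  have hmonic : ∀ i ∈ s, ((X - C (x i)) ^ n i).Monic := fun i _ => (monic_X_sub_C _).pow _
  obtain ⟨ρ, hρ, hle⟩ :=
    exists_mem_Icc_pow_natDegree_le_abs_eval (monic_prod_of_monic _ _ hmonic) hlu
  refine ⟨ρ, hρ, ?_⟩
  simpa only [natDegree_prod_of_monic _ _ hmonic, (monic_X_sub_C _).natDegree_pow,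
    natDegree_X_sub_C, mul_one, eval_prod, eval_pow, eval_sub, eval_X, eval_C, Finset.abs_prod,
    abs_pow] using hle

end Chebyshev

section Blaschke

open ComplexConjugate

/-- The Blaschke factor of the disc of radius `r` about the origin with its zero at `a`, the
inverse of `Complex.canonicalFactor`. Where `conj a * w = r ^ 2`, it takes the junk value `0`. -/
noncomputable def blaschkeFactor (r : ℝ) (a w : ℂ) : ℂ := r * (w - a) / (r ^ 2 - conj a * w)

variable {r α β : ℝ} {a w : ℂ}

theorem sq_sub_conj_mul_ne_zero (h : ‖a‖ * ‖w‖ < r ^ 2) : (r : ℂ) ^ 2 - conj a * w ≠ 0 := by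
  refine sub_ne_zero.2 fun heq => h.ne' ?_
  simpa using congrArg norm heq

theorem norm_sq_sub_conj_mul_sq (r : ℝ) (a w : ℂ) :
    ‖(r : ℂ) ^ 2 - conj a * w‖ ^ 2 =
      (r * ‖w - a‖) ^ 2 + (r ^ 2 - ‖a‖ ^ 2) * (r ^ 2 - ‖w‖ ^ 2) := by
  rw [mul_pow, ← Complex.ofReal_pow]
  simp only [← Complex.normSq_eq_norm_sq, Complex.normSq_apply, Complex.sub_re, Complex.sub_im,
    Complex.mul_re, Complex.mul_im, Complex.conj_re, Complex.conj_im, Complex.ofReal_re,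
    Complex.ofReal_im]
  ring

theorem norm_blaschkeFactor (hr : 0 ≤ r) (a w : ℂ) :
    ‖blaschkeFactor r a w‖ = r * ‖w - a‖ / ‖(r : ℂ) ^ 2 - conj a * w‖ := by
  rw [blaschkeFactor, norm_div, norm_mul, Complex.norm_of_nonneg hr]

theorem norm_blaschkeFactor_eq_one (ha : ‖a‖ < r) (hw : ‖w‖ = r) : ‖blaschkeFactor r a w‖ = 1 := by
  have hr : 0 < r := (norm_nonneg a).trans_lt ha
  have hne : (r : ℂ) ^ 2 - conj a * w ≠ 0 :=
    sq_sub_conj_mul_ne_zero (by rw [hw, sq]; exact mul_lt_mul_of_pos_right ha hr)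
  have hsq := norm_sq_sub_conj_mul_sq r a w
  rw [hw, sub_self, mul_zero, add_zero] at hsq
  rw [norm_blaschkeFactor hr.le, ← (sq_eq_sq₀ (norm_nonneg _) (by positivity)).1 hsq,
    div_self (norm_ne_zero_iff.2 hne)]

theorem norm_blaschkeFactor_le (ha : ‖a‖ ≤ α) (hα : α < r) (hw : ‖w‖ ≤ β) (hβ : β ≤ r) :
    ‖blaschkeFactor r a w‖ ≤ r * (α + β) / (r ^ 2 + α * β) := by
  have har : ‖a‖ ≤ r := ha.trans hα.le
  have hα0 : 0 ≤ α := (norm_nonneg a).trans ha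
  have hβ0 : 0 ≤ β := (norm_nonneg w).trans hw
  have hr : 0 < r := hα0.trans_lt hα
  have hwr : ‖a‖ * ‖w‖ < r ^ 2 := by nlinarith [norm_nonneg a, norm_nonneg w]
  have hdist : ‖w - a‖ ≤ α + β := (norm_sub_le _ _).trans (by linarith)
  have hgap : (r ^ 2 - α ^ 2) * (r ^ 2 - β ^ 2) ≤ (r ^ 2 - ‖a‖ ^ 2) * (r ^ 2 - ‖w‖ ^ 2) := by
    gcongr
    · exact sub_nonneg.2 (by gcongr)
    · exact sub_nonneg.2 (by gcongr)
  have hgap0 : 0 ≤ (r ^ 2 - α ^ 2) * (r ^ 2 - β ^ 2) :=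
    mul_nonneg (sub_nonneg.2 (by gcongr)) (sub_nonneg.2 (by gcongr))
  rw [norm_blaschkeFactor hr.le, div_le_div_iff₀ (norm_pos_iff.2 (sq_sub_conj_mul_ne_zero hwr))
    (by positivity), mul_assoc, mul_assoc]
  refine mul_le_mul_of_nonneg_left (abs_le_of_sq_le_sq' ?_ (by positivity)).2 hr.le
  have hdist2 : ‖w - a‖ ^ 2 ≤ (α + β) ^ 2 := by gcongr
  calc (‖w - a‖ * (r ^ 2 + α * β)) ^ 2
      = (r * (α + β) * ‖w - a‖) ^ 2 + ‖w - a‖ ^ 2 * ((r ^ 2 - α ^ 2) * (r ^ 2 - β ^ 2)) := by ring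
    _ ≤ (r * (α + β) * ‖w - a‖) ^ 2 +
        (α + β) ^ 2 * ((r ^ 2 - ‖a‖ ^ 2) * (r ^ 2 - ‖w‖ ^ 2)) := by gcongr
    _ = ((α + β) * ‖(r : ℂ) ^ 2 - conj a * w‖) ^ 2 := by
      rw [mul_pow (α + β), norm_sq_sub_conj_mul_sq]; ring

theorem mul_abs_sub_div_le_norm_blaschkeFactor (hr : 0 < r) (hw : ‖a‖ * ‖w‖ < r ^ 2) :
    r * |‖w‖ - ‖a‖| / (r ^ 2 + ‖a‖ * ‖w‖) ≤ ‖blaschkeFactor r a w‖ := by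
  rw [norm_blaschkeFactor hr.le]
  have hpos := norm_pos_iff.2 (sq_sub_conj_mul_ne_zero hw)
  have hden : ‖(r : ℂ) ^ 2 - conj a * w‖ ≤ r ^ 2 + ‖a‖ * ‖w‖ := by
    refine (norm_sub_le _ _).trans_eq ?_
    rw [norm_mul, RCLike.norm_conj, norm_pow, Complex.norm_of_nonneg hr.le]
  gcongr
  exact abs_norm_sub_norm_le w a

theorem prod_norm_blaschkeFactor_pow_le (s : Finset ℂ) (n : ℂ → ℕ) (hs : ∀ a ∈ s, ‖a‖ ≤ α)
    (hα : α < r) (hw : ‖w‖ ≤ β) (hβ : β ≤ r) :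
    ∏ a ∈ s, ‖blaschkeFactor r a w‖ ^ n a ≤ (r * (α + β) / (r ^ 2 + α * β)) ^ ∑ a ∈ s, n a := by
  rw [← Finset.prod_pow_eq_pow_sum]
  exact Finset.prod_le_prod (fun a _ => by positivity) fun a ha =>
    pow_le_pow_left₀ (norm_nonneg _) (norm_blaschkeFactor_le (hs a ha) hα hw hβ) _

theorem exists_mem_Icc_pow_le_prod_norm_blaschkeFactor_pow (s : Finset ℂ) (n : ℂ → ℕ)
    (hs : ∀ a ∈ s, ‖a‖ ≤ α) (hα0 : 0 ≤ α) (hα : α < r) {l u : ℝ} (hl : 0 ≤ l) (hlu : l < u)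
    (hu : u ≤ r) :
    ∃ ρ ∈ Icc l u, ∀ w : ℂ, ‖w‖ = ρ →
      (r * ((u - l) / 4) / (r ^ 2 + α * u)) ^ ∑ a ∈ s, n a ≤
        ∏ a ∈ s, ‖blaschkeFactor r a w‖ ^ n a := by
  obtain ⟨ρ, hρ, hle⟩ := exists_mem_Icc_pow_sum_le_prod_abs_sub s n norm hlu
  refine ⟨ρ, hρ, fun w hw => ?_⟩
  have hr : 0 < r := hα0.trans_lt hα
  have hu0 : 0 ≤ u := hl.trans hlu.le
  have hwu : ‖w‖ ≤ u := hw.trans_le hρ.2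
  have hfactor : ∀ a ∈ s, r / (r ^ 2 + α * u) * |ρ - ‖a‖| ≤ ‖blaschkeFactor r a w‖ := by
    intro a ha
    have hlt : ‖a‖ * ‖w‖ < r ^ 2 := calc
      ‖a‖ * ‖w‖ ≤ α * r := mul_le_mul (hs a ha) (hwu.trans hu) (norm_nonneg w) hα0
      _ < r ^ 2 := by rw [sq]; gcongr
    refine le_trans ?_ (mul_abs_sub_div_le_norm_blaschkeFactor hr hlt)
    rw [← hw, div_mul_eq_mul_div]
    have := hs a ha
    gcongr
  calc (r * ((u - l) / 4) / (r ^ 2 + α * u)) ^ ∑ a ∈ s, n a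
      = (r / (r ^ 2 + α * u)) ^ (∑ a ∈ s, n a) * ((u - l) / 4) ^ ∑ a ∈ s, n a := by
        rw [← mul_pow, div_mul_eq_mul_div]
    _ ≤ (r / (r ^ 2 + α * u)) ^ (∑ a ∈ s, n a) * ∏ a ∈ s, |ρ - ‖a‖| ^ n a := by gcongr
    _ = ∏ a ∈ s, (r / (r ^ 2 + α * u) * |ρ - ‖a‖|) ^ n a := by
        simp only [mul_pow, Finset.prod_mul_distrib, Finset.prod_pow_eq_pow_sum]
    _ ≤ ∏ a ∈ s, ‖blaschkeFactor r a w‖ ^ n a :=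
        Finset.prod_le_prod (fun a _ => by positivity) fun a ha =>
          pow_le_pow_left₀ (by positivity) (hfactor a ha) _

theorem exists_eq_prod_blaschkeFactor_mul {f : ℂ → ℂ} {r₁ M : ℝ} (hr : 0 < r) (hr₁ : r₁ < r)
    (hf : AnalyticOnNhd ℂ f (closedBall 0 r)) (hfM : ∀ w ∈ sphere 0 r, ‖f w‖ ≤ M)
    (hne : ∃ w ∈ closedBall 0 r, f w ≠ 0) :
    ∃ (s : Finset ℂ) (n : ℂ → ℕ) (H : ℂ → ℂ), (∀ a ∈ s, ‖a‖ ≤ r₁) ∧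
      HasZeroCount f (closedBall 0 r₁) (∑ a ∈ s, n a) ∧
      AnalyticOnNhd ℂ H (closedBall 0 r) ∧ (∀ w ∈ closedBall 0 r₁, H w ≠ 0) ∧
      (∀ w ∈ closedBall 0 r, ‖H w‖ ≤ M) ∧
      ∀ w ∈ closedBall 0 r, f w = (∏ a ∈ s, blaschkeFactor r a w ^ n a) * H w := by
  have hsub : closedBall (0 : ℂ) r₁ ⊆ closedBall 0 r := closedBall_subset_closedBall hr₁.le
  have hconn : IsPreconnected (closedBall (0 : ℂ) r) := (convex_closedBall 0 r).isPreconnected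
  obtain ⟨s, h, hs, hh, hh0, hfh⟩ :=
    exists_eq_prod_zeros_smul hf hconn hne (isCompact_closedBall 0 r₁) hsub
  have hsr₁ : ∀ a ∈ s, ‖a‖ ≤ r₁ := fun a ha => mem_closedBall_zero_iff.1 ((hs a).1 ha).1
  set n : ℂ → ℕ := analyticOrderNatAt f
  have hr0 : (r : ℂ) ≠ 0 := Complex.ofReal_ne_zero.2 hr.ne'
  have hden : ∀ a ∈ s, ∀ w ∈ closedBall (0 : ℂ) r, (r : ℂ) ^ 2 - conj a * w ≠ 0 := by
    intro a ha w hw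
    refine sq_sub_conj_mul_ne_zero ?_
    rw [sq]
    exact mul_lt_mul_of_nonneg_of_pos ((hsr₁ a ha).trans_lt hr₁) (mem_closedBall_zero_iff.1 hw)
      (norm_nonneg a) hr
  set H : ℂ → ℂ := fun w => (∏ a ∈ s, ((r ^ 2 - conj a * w) / r) ^ n a) * h w with hH_def
  have hH : AnalyticOnNhd ℂ H (closedBall 0 r) := fun w hw =>
    (Finset.analyticAt_fun_prod _ fun a _ => by fun_prop).mul (hh w hw)
  have hfH : ∀ w ∈ closedBall (0 : ℂ) r,
      f w = (∏ a ∈ s, blaschkeFactor r a w ^ n a) * H w := by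
    intro w hw
    rw [hfh, hH_def, smul_eq_mul, ← mul_assoc, ← Finset.prod_mul_distrib]
    congr 1
    refine Finset.prod_congr rfl fun a ha => ?_
    rw [← mul_pow, blaschkeFactor, div_mul_div_cancel₀ (hden a ha w hw), mul_div_cancel_left₀ _ hr0]
  refine ⟨s, n, H, hsr₁, ?_, hH, fun w hw => ?_, fun w hw => ?_, hfH⟩
  · exact HasZeroCount.sum_analyticOrderNatAt hs fun a ha =>
      analyticOrderAt_ne_top_of_exists_ne_zero hf hconn hne (hsub ((hs a).1 ha).1)
  · exact mul_ne_zero (Finset.prod_ne_zero_iff.2 fun a ha =>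
      pow_ne_zero _ (div_ne_zero (hden a ha w (hsub hw)) hr0)) (hh0 w hw)
  · have hcl : closure (ball (0 : ℂ) r) = closedBall 0 r := closure_ball 0 hr.ne'
    refine Complex.norm_le_of_forall_mem_frontier_norm_le isBounded_ball
      (DifferentiableOn.diffContOnCl (hcl ▸ hH.differentiableOn)) (fun z hz => ?_) (hcl ▸ hw)
    rw [frontier_ball 0 hr.ne'] at hz
    have hz' : ‖z‖ = r := mem_sphere_zero_iff_norm.1 hz
    have hone : ∀ a ∈ s, ‖blaschkeFactor r a z ^ n a‖ = 1 := fun a ha => by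
      rw [norm_pow, norm_blaschkeFactor_eq_one ((hsr₁ a ha).trans_lt hr₁) hz', one_pow]
    have := hfM z hz
    rwa [hfH z (sphere_subset_closedBall hz), norm_mul, norm_prod, Finset.prod_congr rfl hone,
      Finset.prod_const_one, one_mul] at this

end Blaschke

theorem exists_circle_mul_pow_mul_pow_le_norm {f : ℂ → ℂ} {w₀ : ℂ} {r M : ℝ} (hr : 0 < r)
    (hf : AnalyticOnNhd ℂ f (closedBall 0 r)) (hfM : ∀ w ∈ sphere 0 r, ‖f w‖ ≤ M)
    (hw₀ : ‖w₀‖ ≤ r / 2) (hfw₀ : f w₀ ≠ 0) :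
    ∃ N : ℕ, HasZeroCount f (closedBall 0 (3 / 4 * r)) N ∧ ‖f w₀‖ / M ≤ (10 / 11) ^ N ∧
      ∃ ρ ∈ Icc (r / 4) (r / 2), ∀ w : ℂ, ‖w‖ = ρ →
        M * (‖f w₀‖ / M) ^ 25 * (1 / 22) ^ N ≤ ‖f w‖ := by
  have hα : 3 / 4 * r < r := by linarith
  have hhalf : closedBall (0 : ℂ) (r / 2) ⊆ closedBall 0 r :=
    closedBall_subset_closedBall (half_le_self hr.le)
  rw [← mem_closedBall_zero_iff] at hw₀
  obtain ⟨s, n, H, hs, hcount, hH, hH0, hHM, hfH⟩ :=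
    exists_eq_prod_blaschkeFactor_mul hr hα hf hfM ⟨w₀, hhalf hw₀, hfw₀⟩
  obtain ⟨ρ, hρ, hcirc⟩ := exists_mem_Icc_pow_le_prod_norm_blaschkeFactor_pow s n hs
    (by positivity) hα (show 0 ≤ r / 4 by positivity) (show r / 4 < r / 2 by linarith) (by linarith)
  set N := ∑ a ∈ s, n a
  have hfnorm : ∀ w ∈ closedBall (0 : ℂ) (r / 2),
      ‖f w‖ = (∏ a ∈ s, ‖blaschkeFactor r a w‖ ^ n a) * ‖H w‖ := fun w hw => by
    simp only [hfH w (hhalf hw), norm_mul, norm_prod, norm_pow]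
  have hprod₀ : ∏ a ∈ s, ‖blaschkeFactor r a w₀‖ ^ n a ≤ (10 / 11) ^ N := by
    convert prod_norm_blaschkeFactor_pow_le s n hs hα (mem_closedBall_zero_iff.1 hw₀)
      (half_le_self hr.le) using 2
    field_simp
    norm_num
  have hM : 0 < M := (norm_pos_iff.2 (right_ne_zero_of_mul (hfH w₀ (hhalf hw₀) ▸ hfw₀))).trans_le
    (hHM w₀ (hhalf hw₀))
  have hfH₀ : ‖f w₀‖ ≤ ‖H w₀‖ := by
    rw [hfnorm w₀ hw₀]
    exact mul_le_of_le_one_left (norm_nonneg _)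
      (hprod₀.trans (pow_le_one₀ (by norm_num) (by norm_num)))
  refine ⟨N, hcount, ?_, ρ, hρ, fun w hw => ?_⟩
  · rw [hfnorm w₀ hw₀, div_le_iff₀ hM]
    gcongr
    exact hHM w₀ (hhalf hw₀)
  · have hw' : w ∈ closedBall (0 : ℂ) (r / 2) := mem_closedBall_zero_iff.2 (hw.trans_le hρ.2)
    have hHw := mul_norm_div_rpow_le_norm (fun z hz => hH z (closedBall_subset_closedBall hα.le hz))
      hH0 (fun z hz => hHM z (closedBall_subset_closedBall hα.le (sphere_subset_closedBall hz)))
      (by linarith) hw₀ hw'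
    rw [show ((3 / 4 * r + r / 2) / (3 / 4 * r - r / 2)) ^ 2 = (25 : ℕ) by field_simp; norm_num,
      Real.rpow_natCast] at hHw
    have hbase : r * ((r / 2 - r / 4) / 4) / (r ^ 2 + 3 / 4 * r * (r / 2)) = 1 / 22 := by
      field_simp
      norm_num
    rw [hfnorm w hw', mul_comm (∏ a ∈ s, _)]
    exact mul_le_mul (le_trans (by gcongr) hHw) (hbase ▸ hcirc w hw) (by positivity) (norm_nonneg _)

theorem exists_circle_mul_pow_le_norm {f : ℂ → ℂ} {w₀ : ℂ} {r M : ℝ} (hr : 0 < r)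
    (hf : AnalyticOnNhd ℂ f (closedBall 0 r)) (hfM : ∀ w ∈ sphere 0 r, ‖f w‖ ≤ M)
    (hw₀ : ‖w₀‖ ≤ r / 2) (hfw₀ : f w₀ ≠ 0) (hM : 0 < M) :
    ∃ ρ ∈ Icc (r / 4) (r / 2), ∃ e : ℕ, (∀ w : ℂ, ‖w‖ = ρ → M * (‖f w₀‖ / M) ^ 58 ≤ ‖f w‖) ∧
      HasZeroCount f (ball 0 ρ) e ∧ ‖f w₀‖ / M ≤ (10 / 11) ^ e := by
  obtain ⟨N, hN, hqN, ρ, hρ, hcirc⟩ := exists_circle_mul_pow_mul_pow_le_norm hr hf hfM hw₀ hfw₀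
  set q := ‖f w₀‖ / M
  have _ : 0 < q := div_pos (norm_pos_iff.2 hfw₀) hM
  -- The exponent is `25 + 33`, where `33` is the least `k` with `(10 / 11) ^ k ≤ 1 / 22`.
  have hlower : ∀ w : ℂ, ‖w‖ = ρ → M * q ^ 58 ≤ ‖f w‖ := fun w hw => calc
    M * q ^ 58 = M * q ^ 25 * q ^ 33 := by ring
    _ ≤ M * q ^ 25 * ((10 / 11) ^ 33) ^ N := by rw [pow_right_comm]; gcongr
    _ ≤ M * q ^ 25 * (1 / 22) ^ N := by gcongr; norm_num
    _ ≤ ‖f w‖ := hcirc w hw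
  have hρr : closedBall (0 : ℂ) ρ ⊆ closedBall 0 (3 / 4 * r) :=
    closedBall_subset_closedBall (by linarith [hρ.2])
  obtain ⟨e, he, -⟩ := exists_hasZeroCount_circleIntegral_logDeriv_eq (c := 0) (ρ := ρ)
    (by linarith [hρ.1]) (hf.mono (hρr.trans (closedBall_subset_closedBall (by linarith))))
    fun w hw => norm_pos_iff.1
      ((by positivity : 0 < M * q ^ 58).trans_le (hlower w (mem_sphere_zero_iff_norm.1 hw)))
  refine ⟨ρ, hρ, e, hlower, he, hqN.trans (pow_le_pow_of_le_one (by norm_num) (by norm_num) ?_)⟩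
  exact he.mono hN (ball_subset_closedBall.trans hρr)

theorem dist_le_two_mul_div_mul_dist_of_norm_le {E : Type*} [NormedAddCommGroup E]
    [NormedSpace ℂ E] {f : E → ℂ} {x q : E} {r M : ℝ} (hf : DifferentiableOn ℂ f (ball q r))
    (hM : ∀ y ∈ ball q r, ‖f y‖ ≤ M) (hx : x ∈ ball q r) :
    dist (f x) (f q) ≤ 2 * M / r * dist x q := by
  refine Complex.dist_le_div_mul_dist_of_mapsTo_ball hf (fun y hy => ?_) hx
  calc dist (f y) (f q) ≤ ‖f y‖ + ‖f q‖ := dist_le_norm_add_norm _ _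
    _ ≤ M + M := add_le_add (hM y hy) (hM q (mem_ball_self (pos_of_mem_ball hx)))
    _ = 2 * M := (two_mul M).symm


namespace StdPolydisc

section Coordinates

variable {n m k : ℕ} (Δ : StdPolydisc n m k)

@[simp]
theorem projZ_point (z : Fin m → ℂ) (w : Fin k → ℂ) : Δ.projZ (Δ.point z w) = z := by
  funext i
  simp [projZ, point]

@[simp]
theorem projW_point (z : Fin m → ℂ) (w : Fin k → ℂ) : Δ.projW (Δ.point z w) = w := by
  funext j
  simp [projW, point]

@[simp]
theorem point_projZ_projW (x : EuclideanSpace ℂ (Fin n)) :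
    Δ.point (Δ.projZ x) (Δ.projW x) = x := by
  rw [point, AffineIsometryEquiv.symm_apply_eq]
  ext (i | j) <;> rfl

theorem differentiable_uncurry_point : Differentiable ℂ (Function.uncurry Δ.point) := by
  have hcoord : Differentiable ℂ Δ.coord.symm :=
    Δ.coord.symm.toAffineIsometry.toContinuousAffineMap.differentiable
  have helim : Differentiable ℂ fun a : (Fin m → ℂ) × (Fin k → ℂ) => Sum.elim a.1 a.2 :=
    differentiable_pi.2 <| by
      rintro (i | j) <;> simp only [Sum.elim_inl, Sum.elim_inr] <;> fun_prop
  exact hcoord.comp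
    ((PiLp.continuousLinearEquiv 2 ℂ fun _ => ℂ).symm.differentiable.comp helim)

theorem point_mem_closure_carrier {z : Fin m → ℂ} {w : Fin k → ℂ} (hz : z ∈ closure Δ.base)
    (hw : w ∈ closure Δ.fiber) : Δ.point z w ∈ closure Δ.carrier :=
  map_mem_closure₂ Δ.differentiable_uncurry_point.continuous hz hw fun z hz w hw => by
    simpa [carrier] using And.intro hz hw

theorem norm_sub_zCenter_le_of_mem_closure_base {z : Fin m → ℂ} (hz : z ∈ closure Δ.base)
    (i : Fin m) : ‖z i - Δ.zCenter i‖ ≤ Δ.zRadius i := by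
  have hclosed : IsClosed {z : Fin m → ℂ | ‖z i - Δ.zCenter i‖ ≤ Δ.zRadius i} :=
    isClosed_le (by fun_prop) continuous_const
  exact closure_minimal (fun z hz => (hz i).le) hclosed hz

theorem dist_point_point (z z' : Fin m → ℂ) (w w' : Fin k → ℂ) :
    dist (Δ.point z w) (Δ.point z' w') =
      √(∑ i, ‖z i - z' i‖ ^ 2 + ∑ j, ‖w j - w' j‖ ^ 2) := by
  simp [point, EuclideanSpace.dist_eq, Complex.dist_eq, Fintype.sum_sum_type]

theorem dist_point_point_left_le {z z' : Fin m → ℂ} {δ : ℝ} (hδ : 0 ≤ δ)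
    (hz : ∀ i, ‖z i - z' i‖ ≤ δ) (w : Fin k → ℂ) :
    dist (Δ.point z w) (Δ.point z' w) ≤ √m * δ := by
  rw [dist_point_point, ← Real.sqrt_sq hδ, ← Real.sqrt_mul (Nat.cast_nonneg m)]
  refine Real.sqrt_le_sqrt ?_
  calc ∑ i, ‖z i - z' i‖ ^ 2 + ∑ j, ‖w j - w j‖ ^ 2
      = ∑ i, ‖z i - z' i‖ ^ 2 := by simp
    _ ≤ ∑ _i : Fin m, δ ^ 2 := Finset.sum_le_sum fun i _ => by gcongr; exact hz i
    _ = m * δ ^ 2 := by simp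

theorem ball_subset_carrier {δ : ℝ} (hz : ∀ i, δ ≤ Δ.zRadius i) (hw : ∀ j, δ ≤ Δ.wRadius j) :
    ball (Δ.point Δ.zCenter Δ.wCenter) δ ⊆ Δ.carrier := by
  intro x hx
  rw [mem_ball, ← Δ.coord.dist_map, dist_eq_norm, point,
    AffineIsometryEquiv.apply_symm_apply] at hx
  have hcoord := fun l => (PiLp.norm_apply_le _ l).trans_lt hx
  exact ⟨fun i => (hcoord (Sum.inl i)).trans_le (hz i),
    fun j => (hcoord (Sum.inr j)).trans_le (hw j)⟩

end Coordinates

section Hypersurface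

variable {n m : ℕ} (Δ : StdPolydisc n m 1)

theorem dist_point_point_right (z : Fin m → ℂ) (w w' : Fin 1 → ℂ) :
    dist (Δ.point z w) (Δ.point z w') = dist (w 0) (w' 0) := by
  simp [dist_point_point, Complex.dist_eq]

theorem carrier_subset_closedBall {δ : ℝ} (hδ : 0 ≤ δ) (hz : ∀ i, Δ.zRadius i ≤ δ) :
    Δ.carrier ⊆ closedBall (Δ.point Δ.zCenter Δ.wCenter) (√m * δ + Δ.wRadius 0) := by
  rintro x ⟨hxz, hxw⟩
  rw [← Δ.point_projZ_projW x]
  refine (dist_triangle _ (Δ.point Δ.zCenter (Δ.projW x)) _).trans (add_le_add ?_ ?_)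
  · exact Δ.dist_point_point_left_le hδ (fun i => (hxz i).le.trans (hz i)) _
  · rw [dist_point_point_right, dist_eq_norm]
    exact (hxw 0).le

theorem closure_carrier_subset_ball {δ r : ℝ} (hδ : 0 ≤ δ) (hz : ∀ i, Δ.zRadius i ≤ δ)
    (hr : √m * δ + Δ.wRadius 0 < r) :
    closure Δ.carrier ⊆ ball (Δ.point Δ.zCenter Δ.wCenter) r :=
  (closure_minimal (Δ.carrier_subset_closedBall hδ hz) isClosed_closedBall).trans
    (closedBall_subset_ball hr)

theorem setOf_const_mem_fiber :
    {w : ℂ | (fun _ => w) ∈ Δ.fiber} = ball (Δ.wCenter 0) (Δ.wRadius 0) := by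
  ext w
  simp [fiber, Complex.dist_eq]

theorem const_mem_closure_fiber {w : ℂ} (hw : w ∈ closedBall (Δ.wCenter 0) (Δ.wRadius 0)) :
    (fun _ => w) ∈ closure Δ.fiber := by
  rw [← closure_ball _ (Δ.wRadius_pos 0).ne', ← Δ.setOf_const_mem_fiber] at hw
  exact map_mem_closure (f := fun (w : ℂ) (_ : Fin 1) => w) (by fun_prop) hw fun _ h => h

theorem apply_zero_mem_sphere_of_mem_frontier_fiber {w : Fin 1 → ℂ}
    (hw : w ∈ frontier Δ.fiber) : w 0 ∈ sphere (Δ.wCenter 0) (Δ.wRadius 0) := by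
  have hfiber : Δ.fiber = {w | ‖w 0 - Δ.wCenter 0‖ < Δ.wRadius 0} := by
    ext w
    simp [fiber]
  rw [hfiber] at hw
  rw [mem_sphere_iff_norm]
  exact frontier_lt_subset_eq (f := fun w : Fin 1 → ℂ => ‖w 0 - Δ.wCenter 0‖) (by fun_prop)
    continuous_const hw

theorem point_projZ_const_projW (x : EuclideanSpace ℂ (Fin n)) :
    Δ.point (Δ.projZ x) (fun _ => Δ.projW x 0) = x := by
  have hw : (fun _ => Δ.projW x 0) = Δ.projW x := funext fun j => by rw [Subsingleton.elim j 0]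
  rw [hw, point_projZ_projW]

variable {Δ} {R : EuclideanSpace ℂ (Fin n) → ℂ} {Ω X : Set (EuclideanSpace ℂ (Fin n))}

theorem analyticOnNhd_comp_point (hR : AnalyticOnNhd ℂ R Ω) {z : Fin m → ℂ} {D : Set ℂ}
    (hD : ∀ w ∈ D, Δ.point z (fun _ => w) ∈ Ω) :
    AnalyticOnNhd ℂ (fun w => R (Δ.point z fun _ => w)) D := by
  have hpoint : Differentiable ℂ fun w : ℂ => Δ.point z fun _ => w :=
    Δ.differentiable_uncurry_point.comp (f := fun w : ℂ => (z, fun _ => w)) (by fun_prop)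
  exact fun w hw => (hR _ (hD w hw)).comp
    (f := fun w : ℂ => Δ.point z fun _ => w) (hpoint.analyticAt w)

theorem HasCycleDegree.degree_le {e : ℕ} (he : Δ.HasCycleDegree R e)
    (hR : AnalyticOnNhd ℂ R Δ.carrier) (hX : ∀ x ∈ X, R x = 0) : Δ.degree X ≤ e := by
  refine iSup₂_le fun z hz => ?_
  obtain ⟨s, hs, hse⟩ := (he z hz).exists_card_le
    (analyticOnNhd_comp_point hR fun w hw => by simpa [carrier] using And.intro hz hw)
  have hsub : X ∩ Δ.carrier ∩ {x | Δ.projZ x = z} ⊆ (fun w => Δ.point z fun _ => w) '' s := by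
    rintro x ⟨⟨hxX, hxΔ⟩, rfl⟩
    have hpoint := Δ.point_projZ_const_projW x
    refine ⟨Δ.projW x 0, (hs _).2 ⟨?_, ?_⟩, hpoint⟩
    · have hmem := hxΔ.2
      rwa [← hpoint, projW_point] at hmem
    · rw [hpoint, hX x hxX]
  calc (X ∩ Δ.carrier ∩ {x | Δ.projZ x = z}).encard
      ≤ ((fun w => Δ.point z fun _ => w) '' (s : Set ℂ)).encard := encard_le_encard hsub
    _ ≤ (s : Set ℂ).encard := encard_image_le _ _
    _ = s.card := encard_coe_eq_coe_finsetCard s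
    _ ≤ e := by exact_mod_cast hse

theorem isWeierstrass_of_norm_sub_lt_norm (hΩ : closure Δ.carrier ⊆ Ω)
    (hper : ∀ z ∈ closure Δ.base, ∀ w ∈ sphere (Δ.wCenter 0) (Δ.wRadius 0),
      ‖R (Δ.point z fun _ => w) - R (Δ.point Δ.zCenter fun _ => w)‖ <
        ‖R (Δ.point Δ.zCenter fun _ => w)‖)
    (hX : ∀ x ∈ X, R x = 0) : Δ.IsWeierstrass Ω X := by
  refine ⟨hΩ, eq_empty_iff_forall_notMem.2 ?_⟩
  rintro x ⟨⟨hxz, hxw⟩, hxX⟩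
  have h := hper _ hxz _ (Δ.apply_zero_mem_sphere_of_mem_frontier_fiber hxw)
  rw [point_projZ_const_projW, hX x hxX, zero_sub, norm_neg] at h
  exact lt_irrefl _ h

theorem hasCycleDegree_of_norm_sub_lt_norm {e : ℕ} (hR : AnalyticOnNhd ℂ R (closure Δ.carrier))
    (hper : ∀ z ∈ Δ.base, ∀ w ∈ sphere (Δ.wCenter 0) (Δ.wRadius 0),
      ‖R (Δ.point z fun _ => w) - R (Δ.point Δ.zCenter fun _ => w)‖ <
        ‖R (Δ.point Δ.zCenter fun _ => w)‖)
    (he : HasZeroCount (fun w => R (Δ.point Δ.zCenter fun _ => w))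
      (ball (Δ.wCenter 0) (Δ.wRadius 0)) e) : Δ.HasCycleDegree R e := by
  have hfiber : ∀ z ∈ Δ.base, AnalyticOnNhd ℂ (fun w => R (Δ.point z fun _ => w))
      (closedBall (Δ.wCenter 0) (Δ.wRadius 0)) := fun z hz =>
    analyticOnNhd_comp_point hR fun w hw =>
      Δ.point_mem_closure_carrier (subset_closure hz) (Δ.const_mem_closure_fiber hw)
  have hcenter : Δ.zCenter ∈ Δ.base := fun i => by simpa using Δ.zRadius_pos i
  intro z hz
  rw [setOf_const_mem_fiber]
  exact HasZeroCount.of_norm_sub_lt_norm (Δ.wRadius_pos 0).le (hfiber _ hcenter) (hfiber z hz)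
    (hper z hz) he

theorem norm_sub_lt_norm_of_le_norm {r M c δ : ℝ} (hδ : 0 ≤ δ) (hz : ∀ i, Δ.zRadius i ≤ δ)
    (hw : Δ.wRadius 0 ≤ r / 2)
    (hR : DifferentiableOn ℂ R (ball (Δ.point Δ.zCenter Δ.wCenter) r))
    (hM : ∀ x ∈ ball (Δ.point Δ.zCenter Δ.wCenter) r, ‖R x‖ ≤ M)
    (hc : ∀ w ∈ sphere (Δ.wCenter 0) (Δ.wRadius 0), c ≤ ‖R (Δ.point Δ.zCenter fun _ => w)‖)
    (hδc : 4 * M * (√m * δ) < r * c) {z : Fin m → ℂ} (hzb : z ∈ closure Δ.base)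
    {w : ℂ} (hws : w ∈ sphere (Δ.wCenter 0) (Δ.wRadius 0)) :
    ‖R (Δ.point z fun _ => w) - R (Δ.point Δ.zCenter fun _ => w)‖ <
      ‖R (Δ.point Δ.zCenter fun _ => w)‖ := by
  set q := Δ.point Δ.zCenter fun _ => w
  have hr : 0 < r := by linarith [Δ.wRadius_pos 0]
  have hq : dist q (Δ.point Δ.zCenter Δ.wCenter) ≤ r / 2 := by
    rw [dist_point_point_right, mem_sphere.1 hws]
    exact hw
  have hball : ball q (r / 2) ⊆ ball (Δ.point Δ.zCenter Δ.wCenter) r :=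
    ball_subset_ball' (by linarith)
  have hqM : ‖R q‖ ≤ M := hM q (hball (mem_ball_self (half_pos hr)))
  have hdist : dist (Δ.point z fun _ => w) q ≤ √m * δ := Δ.dist_point_point_left_le hδ
    (fun i => (Δ.norm_sub_zCenter_le_of_mem_closure_base hzb i).trans (hz i)) _
  have hsmall : √m * δ < r / 2 := by
    by_contra! hle
    nlinarith [mul_le_mul_of_nonneg_left hle ((norm_nonneg _).trans hqM),
      mul_le_mul_of_nonneg_left ((hc w hws).trans hqM) hr.le, norm_nonneg (R q)]
  rw [← dist_eq_norm]
  calc dist (R (Δ.point z fun _ => w)) (R q)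
      ≤ 2 * M / (r / 2) * dist (Δ.point z fun _ => w) q :=
        dist_le_two_mul_div_mul_dist_of_norm_le (hR.mono hball) (fun y hy => hM y (hball hy))
          (hdist.trans_lt hsmall)
    _ ≤ 2 * M / (r / 2) * (√m * δ) := by
        have := (norm_nonneg _).trans hqM
        gcongr
    _ = 4 * M * (√m * δ) / r := by field_simp; ring
    _ < c := by rwa [div_lt_iff₀' hr]
    _ ≤ ‖R q‖ := hc w hws

end Hypersurface

theorem exists_point_zCenter_eq_add_smul {m : ℕ} (p : EuclideanSpace ℂ (Fin (m + 1)))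
    {v : EuclideanSpace ℂ (Fin (m + 1))} (hv : ‖v‖ = 1) {δ ρ : ℝ} (hδ : 0 < δ) (hρ : 0 < ρ) :
    ∃ Δ : StdPolydisc (m + 1) m 1, Δ.wCenter = 0 ∧ (∀ i, Δ.zRadius i = δ) ∧
      (∀ j, Δ.wRadius j = ρ) ∧ ∀ w : ℂ, Δ.point Δ.zCenter (fun _ => w) = p + w • v := by
  have horth : Orthonormal ℂ (({Sum.inr 0} : Set (Fin m ⊕ Fin 1)).domRestrict fun _ => v) :=
    ⟨fun _ => hv, fun i j hij => absurd (Subsingleton.elim i j) hij⟩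
  obtain ⟨β, hβ⟩ := horth.exists_orthonormalBasis_extension_of_card_eq (by simp)
  refine ⟨{ coord := (AffineIsometryEquiv.vaddConst ℂ p).symm.trans β.repr.toAffineIsometryEquiv
            zCenter := 0
            wCenter := 0
            zRadius := fun _ => δ
            wRadius := fun _ => ρ
            zRadius_pos := fun _ => hδ
            wRadius_pos := fun _ => hρ }, rfl, fun _ => rfl, fun _ => rfl, fun w => ?_⟩
  rw [point, AffineIsometryEquiv.symm_apply_eq, ← hβ _ rfl]
  ext (i | j) <;> simp [Subsingleton.elim _ (0 : Fin 1)]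

end StdPolydisc

section BernsteinIndex

theorem maxModulus_eq_of_isMaxOn {E : Type*} [TopologicalSpace E] {A : Set E} {f : E → ℂ} {x : E}
    (hx : x ∈ closure A) (hmax : IsMaxOn (fun y => ‖f y‖) (closure A) x) :
    maxModulus A f = ‖f x‖ :=
  IsGreatest.csSup_eq ⟨mem_image_of_mem _ hx, forall_mem_image.2 hmax⟩

theorem maxModulus_image {E F : Type*} [TopologicalSpace E] [TopologicalSpace F] {i : F → E}
    (hi : IsClosedEmbedding i) (A : Set F) (f : E → ℂ) :
    maxModulus (i '' A) f = maxModulus A (f ∘ i) := by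
  rw [maxModulus, maxModulus, hi.closure_image_eq, image_image]
  rfl

section Line

variable {E : Type*} [NormedAddCommGroup E] [NormedSpace ℂ E] {p v : E}

theorem isometry_add_smul (hv : ‖v‖ = 1) : Isometry fun t : ℂ => p + t • v :=
  Isometry.of_dist_eq fun s t => by
    rw [dist_add_left, dist_eq_norm, ← sub_smul, norm_smul, hv, mul_one, dist_eq_norm]

theorem inter_complexLine (U : Set E) :
    U ∩ complexLine p v = (fun t : ℂ => p + t • v) '' {t | p + t • v ∈ U} := by
  ext x
  constructor
  · rintro ⟨hx, t, rfl⟩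
    exact ⟨t, hx, rfl⟩
  · rintro ⟨t, ht, rfl⟩
    exact ⟨ht, t, rfl⟩

theorem ball_inter_complexLine (hv : ‖v‖ = 1) (r : ℝ) :
    ball p r ∩ complexLine p v = (fun t : ℂ => p + t • v) '' ball 0 r := by
  rw [inter_complexLine]
  congr! 1
  ext t
  simp [norm_smul, hv]

theorem closedBall_inter_complexLine (hv : ‖v‖ = 1) (r : ℝ) :
    closedBall p r ∩ complexLine p v = (fun t : ℂ => p + t • v) '' closedBall 0 r := by
  rw [inter_complexLine]
  congr! 1
  ext t
  simp [norm_smul, hv]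

theorem exists_line_isMaxOn_norm [ProperSpace E] [Nontrivial E] {F : Type*}
    [SeminormedAddCommGroup F] {R : E → F} {r : ℝ} (hr : 0 ≤ r)
    (hR : ContinuousOn R (closedBall p r)) :
    ∃ (v : E) (t : ℂ), ‖v‖ = 1 ∧ ‖t‖ ≤ r ∧
      IsMaxOn (fun x => ‖R x‖) (closedBall p r) (p + t • v) := by
  obtain ⟨q, hq, hmax⟩ := (isCompact_closedBall p r).exists_isMaxOn
    ⟨p, mem_closedBall_self hr⟩ hR.norm
  rcases eq_or_ne q p with rfl | hqp
  · obtain ⟨v, hv⟩ := exists_norm_eq E zero_le_one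
    exact ⟨v, 0, hv, by simpa using hr, by simpa using hmax⟩
  · have hnorm : (‖q - p‖ : ℂ) ≠ 0 :=
      Complex.ofReal_ne_zero.2 (norm_ne_zero_iff.2 (sub_ne_zero.2 hqp))
    refine ⟨((‖q - p‖ : ℂ)⁻¹) • (q - p), ‖q - p‖,
      norm_smul_inv_norm (𝕜 := ℂ) (sub_ne_zero.2 hqp), ?_, ?_⟩
    · rwa [Complex.norm_of_nonneg (norm_nonneg _), ← mem_closedBall_iff_norm]
    · rwa [smul_inv_smul₀ hnorm, add_sub_cancel]

end Line

theorem ofReal_log_div_le_gapBernsteinIndex {n : ℕ} {p v : EuclideanSpace ℂ (Fin n)} {r η : ℝ}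
    {R : EuclideanSpace ℂ (Fin n) → ℂ} (hv : ‖v‖ = 1)
    (hne : ∃ t ∈ ball (0 : ℂ) r, R (p + t • v) ≠ 0) {t₀ t₁ : ℂ} (ht₀ : ‖t₀‖ ≤ r)
    (hmax₀ : IsMaxOn (fun t : ℂ => ‖R (p + t • v)‖) (closedBall 0 r) t₀) (ht₁ : ‖t₁‖ ≤ r / η)
    (hmax₁ : IsMaxOn (fun t : ℂ => ‖R (p + t • v)‖) (closedBall 0 (r / η)) t₁) :
    ENNReal.ofReal (Real.log (‖R (p + t₀ • v)‖ / ‖R (p + t₁ • v)‖)) ≤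
      gapBernsteinIndex η p r R := by
  obtain ⟨t, ht, hRt⟩ := hne
  have hline : IsClosedEmbedding fun t : ℂ => p + t • v := (isometry_add_smul hv).isClosedEmbedding
  have hclosure : closure (ball (0 : ℂ) r) = closedBall 0 r :=
    closure_ball 0 (pos_of_mem_ball ht).ne'
  have hball : maxModulus (ball p r ∩ complexLine p v) R = ‖R (p + t₀ • v)‖ := by
    rw [ball_inter_complexLine hv, maxModulus_image hline]
    refine maxModulus_eq_of_isMaxOn ?_ ?_ <;> rw [hclosure]
    exacts [mem_closedBall_zero_iff.2 ht₀, hmax₀]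
  have hclosedBall :
      maxModulus (closedBall p (r / η) ∩ complexLine p v) R = ‖R (p + t₁ • v)‖ := by
    rw [closedBall_inter_complexLine hv, maxModulus_image hline]
    refine maxModulus_eq_of_isMaxOn ?_ ?_ <;> rw [isClosed_closedBall.closure_eq]
    exacts [mem_closedBall_zero_iff.2 ht₁, hmax₁]
  have hmem : p + t • v ∈ ball p r ∩ complexLine p v := by
    rw [ball_inter_complexLine hv]
    exact mem_image_of_mem _ ht
  rw [← hball, ← hclosedBall]
  exact le_iSup_of_le v (le_iSup_of_le (norm_ne_zero_iff.1 (hv ▸ one_ne_zero))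
    (le_iSup_of_le ⟨_, hmem, hRt⟩ le_rfl))

end BernsteinIndex

section WeierstrassPolydisc

variable {m : ℕ} {p v : EuclideanSpace ℂ (Fin (m + 1))} {r : ℝ}
  {R : EuclideanSpace ℂ (Fin (m + 1)) → ℂ}

theorem exists_isWeierstrass_hasCycleDegree_of_circle {M c δ ρ : ℝ} {e : ℕ} (hv : ‖v‖ = 1)
    (hR : AnalyticOnNhd ℂ R (ball p r)) (hM : ∀ x ∈ ball p r, ‖R x‖ ≤ M)
    (hδ : 0 < δ) (hδρ : δ ≤ ρ) (hρ : ρ ≤ r / 2) (hδr : √m * δ + ρ < r)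
    (hδc : 4 * M * (√m * δ) < r * c) (hc : ∀ w : ℂ, ‖w‖ = ρ → c ≤ ‖R (p + w • v)‖)
    (he : HasZeroCount (fun w => R (p + w • v)) (ball 0 ρ) e) :
    ∃ Δ : StdPolydisc (m + 1) m 1, Δ.IsWeierstrass (ball p r) (ball p r ∩ {x | R x = 0}) ∧
      ball p δ ⊆ Δ.carrier ∧ Δ.carrier ⊆ ball p r ∧ Δ.HasCycleDegree R e := by
  obtain ⟨Δ, hw₀, hz, hw, hpoint⟩ :=
    StdPolydisc.exists_point_zCenter_eq_add_smul p hv hδ (hδ.trans_le hδρ)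
  have hcenter : Δ.point Δ.zCenter Δ.wCenter = p := by
    simpa [hw₀, Pi.zero_def] using hpoint 0
  have hclosure : closure Δ.carrier ⊆ ball p r :=
    hcenter ▸ Δ.closure_carrier_subset_ball hδ.le (fun i => (hz i).le) (by rwa [hw])
  have hper := fun z (hzb : z ∈ closure Δ.base) w hws =>
    StdPolydisc.norm_sub_lt_norm_of_le_norm (R := R) hδ.le (fun i => (hz i).le) ((hw 0).trans_le hρ)
      (by rw [hcenter]; exact hR.differentiableOn) (by rwa [hcenter])
      (fun w hws => by rw [hpoint]; exact hc w (by simpa [hw₀, hw] using hws)) hδc hzb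
      (w := w) hws
  refine ⟨Δ, Δ.isWeierstrass_of_norm_sub_lt_norm hclosure hper fun x hx => hx.2, ?_,
    subset_closure.trans hclosure, Δ.hasCycleDegree_of_norm_sub_lt_norm (hR.mono hclosure)
      (fun z hzb => hper z (subset_closure hzb)) ?_⟩
  · exact hcenter ▸ Δ.ball_subset_carrier (fun i => (hz i).ge) fun j => hδρ.trans_eq (hw j).symm
  · simpa only [hpoint, hw₀, hw, Pi.zero_apply] using he

theorem exists_isWeierstrass_of_norm_le {M : ℝ} {t : ℂ} (hr : 0 < r) (hv : ‖v‖ = 1)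
    (hR : AnalyticOnNhd ℂ R (closedBall p r)) (hM : ∀ x ∈ closedBall p r, ‖R x‖ ≤ M)
    (ht : ‖t‖ ≤ r / 2) (hRt : R (p + t • v) ≠ 0) :
    ∃ (Δ : StdPolydisc (m + 1) m 1) (e : ℕ),
      Δ.IsWeierstrass (ball p r) (ball p r ∩ {x | R x = 0}) ∧
      ball p (r * (‖R (p + t • v)‖ / M) ^ 58 / (8 * √(m + 1))) ⊆ Δ.carrier ∧
      Δ.carrier ⊆ ball p r ∧ Δ.HasCycleDegree R e ∧
      ‖R (p + t • v)‖ / M ≤ (10 / 11) ^ e := by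
  have hline : ∀ w ∈ closedBall (0 : ℂ) r, p + w • v ∈ closedBall p r := fun w hw => by
    simpa [norm_smul, hv] using hw
  have htM : ‖R (p + t • v)‖ ≤ M :=
    hM _ (hline t (mem_closedBall_zero_iff.2 (by linarith)))
  have hM0 : 0 < M := (norm_pos_iff.2 hRt).trans_le htM
  obtain ⟨ρ, hρ, e, hcircle, he, hq⟩ :=
    exists_circle_mul_pow_le_norm (f := fun w => R (p + w • v)) hr
      (fun w hw => (hR _ (hline w hw)).comp (f := fun w : ℂ => p + w • v) (by fun_prop))
      (fun w hw => hM _ (hline w (sphere_subset_closedBall hw))) ht hRt hM0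
  set κ := (‖R (p + t • v)‖ / M) ^ 58
  have hκ0 : 0 < κ := pow_pos (div_pos (norm_pos_iff.2 hRt) hM0) _
  have hκ1 : κ ≤ 1 := pow_le_one₀ (by positivity) ((div_le_one hM0).2 htM)
  have hs1 : 1 ≤ √((m : ℝ) + 1) := Real.one_le_sqrt.2 (by simp)
  set s := √((m : ℝ) + 1)
  have hrκ : r * κ ≤ r := mul_le_of_le_one_right hr.le hκ1
  have hδ : r * κ / (8 * s) ≤ r / 8 :=
    div_le_div₀ hr.le hrκ (by norm_num) (by linarith)
  have hsδ : √m * (r * κ / (8 * s)) ≤ r * κ / 8 := by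
    calc √m * (r * κ / (8 * s)) ≤ s * (r * κ / (8 * s)) := by
          gcongr
          exact Real.sqrt_le_sqrt (by simp)
      _ = r * κ / 8 := by field_simp
  obtain ⟨Δ, hΔ, hball, hcarrier, hcycle⟩ := exists_isWeierstrass_hasCycleDegree_of_circle
    (c := M * κ) (δ := r * κ / (8 * s)) hv (hR.mono ball_subset_closedBall)
    (fun x hx => hM x (ball_subset_closedBall hx)) (by positivity) (by linarith [hρ.1]) hρ.2
    (by linarith [hρ.2]) (by nlinarith [mul_pos (mul_pos hr hκ0) hM0]) hcircle he
  exact ⟨Δ, e, hΔ, hball, hcarrier, hcycle, hq⟩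

end WeierstrassPolydisc

theorem exists_line_ofReal_log_div_le_gapBernsteinIndex {n : ℕ} [NeZero n] {η r : ℝ}
    {p : EuclideanSpace ℂ (Fin n)} {R : EuclideanSpace ℂ (Fin n) → ℂ} (hη : 1 < η) (hr : 0 < r)
    (hR : AnalyticOnNhd ℂ R (closedBall p r)) (hne : ∃ x ∈ ball p r, R x ≠ 0) :
    ∃ (v : EuclideanSpace ℂ (Fin n)) (t : ℂ) (M : ℝ), ‖v‖ = 1 ∧ ‖t‖ ≤ r / η ∧
      R (p + t • v) ≠ 0 ∧ (∀ x ∈ closedBall p r, ‖R x‖ ≤ M) ∧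
      ENNReal.ofReal (Real.log (M / ‖R (p + t • v)‖)) ≤ gapBernsteinIndex η p r R := by
  obtain ⟨v, t₀, hv, ht₀, hmax₀⟩ := exists_line_isMaxOn_norm hr.le hR.continuousOn
  have hrη : r / η < r := div_lt_self hr hη
  have hline : ∀ t ∈ closedBall (0 : ℂ) r, p + t • v ∈ closedBall p r := fun t ht => by
    simpa [norm_smul, hv] using ht
  have hf : AnalyticOnNhd ℂ (fun t : ℂ => R (p + t • v)) (closedBall 0 r) := fun t ht =>
    (hR _ (hline t ht)).comp (f := fun t : ℂ => p + t • v) (by fun_prop)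
  have hRt₀ : R (p + t₀ • v) ≠ 0 := by
    obtain ⟨x, hx, hRx⟩ := hne
    exact norm_pos_iff.1 ((norm_pos_iff.2 hRx).trans_le (hmax₀ (ball_subset_closedBall hx)))
  obtain ⟨t₁, ht₁, hmax₁⟩ := (isCompact_closedBall (0 : ℂ) (r / η)).exists_isMaxOn
    ⟨0, mem_closedBall_self (by positivity)⟩
    (hf.continuousOn.mono (closedBall_subset_closedBall hrη.le)).norm
  have hRt₁ : R (p + t₁ • v) ≠ 0 := fun h0 => by
    refine hRt₀ (hf.eqOn_zero_of_preconnected_of_eventuallyEq_zero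
      (convex_closedBall (0 : ℂ) r).isPreconnected (mem_closedBall_self hr.le) ?_
      (mem_closedBall_zero_iff.2 ht₀))
    filter_upwards [closedBall_mem_nhds (0 : ℂ) (by positivity : 0 < r / η)] with t ht
    simpa [h0] using hmax₁ ht
  rw [mem_closedBall_zero_iff] at ht₁
  exact ⟨v, t₁, _, hv, ht₁, hRt₁, hmax₀, ofReal_log_div_le_gapBernsteinIndex hv
    ⟨t₁, mem_ball_zero_iff.2 (ht₁.trans_lt hrη), hRt₁⟩ ht₀ (fun t ht => hmax₀ (hline t ht)) ht₁
    hmax₁⟩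

theorem log_mul_pow_le {a x : ℝ} (k : ℕ) (ha : 1 ≤ a) (hx : 1 ≤ x) :
    Real.log (a * x ^ k) ≤ (a + k) * (1 + Real.log x) := by
  have hlog : 0 ≤ Real.log x := Real.log_nonneg hx
  rw [Real.log_mul (by positivity) (by positivity), Real.log_pow]
  nlinarith [Real.log_le_sub_one_of_pos (by positivity : 0 < a),
    mul_nonneg (by positivity : 0 ≤ a) hlog]

theorem natCast_le_mul_log_inv {e : ℕ} {q : ℝ} (hq : 0 < q) (hqe : q ≤ (10 / 11) ^ e) :
    (e : ℝ) ≤ 11 * Real.log q⁻¹ := by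
  have hlog : 1 / 11 ≤ Real.log (11 / 10) := by
    simpa using (by norm_num : (1 : ℝ) / 11 = 1 - (11 / 10)⁻¹).le.trans
      (Real.one_sub_inv_le_log_of_pos (by norm_num : (0 : ℝ) < 11 / 10))
  have hpow : e * Real.log (11 / 10) ≤ Real.log q⁻¹ := by
    rw [← Real.log_pow]
    refine Real.log_le_log (by positivity) ?_
    rw [le_inv_comm₀ (by positivity) hq, ← inv_pow, inv_div]
    exact hqe
  nlinarith [(Nat.cast_nonneg e : (0 : ℝ) ≤ e)]

theorem ofReal_le_coe_mul {x b : ℝ} {C : ℝ≥0} {B : ℝ≥0∞} (hx : x ≤ C * b)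
    (hb : ENNReal.ofReal b ≤ B) : ENNReal.ofReal x ≤ C * B :=
  calc ENNReal.ofReal x ≤ ENNReal.ofReal (C * b) := ENNReal.ofReal_le_ofReal hx
    _ = C * ENNReal.ofReal b := by rw [ENNReal.ofReal_mul C.coe_nonneg, ENNReal.ofReal_coe_nnreal]
    _ ≤ C * B := by gcongr

theorem mainTheorem9 :
    ∃ A : ℝ≥0, ∀ m : ℕ, ∃ C : ℝ≥0,
      ∀ (p : EuclideanSpace ℂ (Fin (m + 1))) (r : ℝ) (R : EuclideanSpace ℂ (Fin (m + 1)) → ℂ),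
        0 < r →
        AnalyticOnNhd ℂ R (Metric.closedBall p r) →
        (∃ x ∈ Metric.ball p r, R x ≠ 0) →
        ∃ (Δ : StdPolydisc (m + 1) m 1) (η : ℝ),
          Δ.IsWeierstrass (Metric.ball p r) (Metric.ball p r ∩ {x | R x = 0}) ∧
          1 < η ∧
          ENNReal.ofReal (Real.log η) ≤ C * (1 + gapBernsteinIndex 2 p r R) ∧
          Metric.ball p (r / η) ⊆ Δ.carrier ∧
          Δ.carrier ⊆ Metric.ball p r ∧
          ((Δ.degree (Metric.ball p r ∩ {x | R x = 0}) : ℕ∞) : ℝ≥0∞)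
            ≤ A * gapBernsteinIndex 2 p r R ∧
          ∃ e : ℕ, Δ.HasCycleDegree R e ∧ (e : ℝ≥0∞) ≤ A * gapBernsteinIndex 2 p r R := by
  refine ⟨11, fun m => ⟨8 * NNReal.sqrt (m + 1) + (58 : ℕ), fun p r R hr hR hne => ?_⟩⟩
  obtain ⟨v, t, M, hv, ht, hRt, hM, hb⟩ :=
    exists_line_ofReal_log_div_le_gapBernsteinIndex one_lt_two hr hR hne
  obtain ⟨Δ, e, hΔ, hball, hcarrier, hcycle, he⟩ :=
    exists_isWeierstrass_of_norm_le hr hv hR hM ht hRt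
  rw [← inv_div M] at hball he
  have hx : 1 ≤ M / ‖R (p + t • v)‖ := (one_le_div (norm_pos_iff.2 hRt)).2 <|
    hM _ (by simpa [norm_smul, hv] using ht.trans (half_le_self hr.le))
  set x := M / ‖R (p + t • v)‖
  have heB : (e : ℝ≥0∞) ≤ (11 : ℝ≥0) * gapBernsteinIndex 2 p r R := by
    rw [← ENNReal.ofReal_natCast]
    exact ofReal_le_coe_mul (by simpa using natCast_le_mul_log_inv (by positivity) he) hb
  have hs : 1 ≤ √((m : ℝ) + 1) := Real.one_le_sqrt.2 (by simp)
  refine ⟨Δ, 8 * √(m + 1) * x ^ 58, hΔ, by nlinarith [one_le_pow₀ hx (n := 58)],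
    ofReal_le_coe_mul (by simpa using log_mul_pow_le 58 (by linarith) hx) ?_, ?_, hcarrier,
    le_trans ?_ heB, e, hcycle, heB⟩
  · exact ENNReal.ofReal_add_le.trans (by simpa using hb)
  · convert hball using 2
    field_simp
  · exact_mod_cast ENat.toENNReal_le.2 (hcycle.degree_le (X := ball p r ∩ {x | R x = 0})
      (hR.mono (hcarrier.trans ball_subset_closedBall)) fun _ hy => hy.2)
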